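/- All graphs are finite and simple, and vertices serve as labels. Let $G$ be a graph with vertex set $X$. For $\sigma\in\mathrm{Sym}(X)$ let $G_\sigma$ be the graph on $X$ in which $ij$ is an edge iff $\sigma(i)\sigma(j)\in E(G)$, and let $\mathrm{Aut}(G)=\{\sigma : G_\sigma=G\}$. A feasible edge-replacement of $G$ removes an edge $e\in E(G)$ and adds an edge $e'\in E(\overline G)$ so that $G-e+e'\cong G$; its associated permutations are those $\sigma$ with $G_\sigma=G-e+e'$. The neutral edge-replacement changes nothing, and its associated permutations are the elements of $\mathrm{Aut}(G)$. Let $\mathcal E_G\subseteq\mathrm{Sym}(X)$ be the set of all permutations associated with the neutral or with a feasible edge-replacement, and for $i\in X$ let $\mathcal E_G^i=\{\sigma\in\mathcal E_G:\sigma(i)=i\}$. The graph $G$ is a local amoeba if $\langle\mathcal E_G\rangle=\mathrm{Sym}(X)$, and a global amoeba if $G\cup tK_1$ is a local amoeba for some integer $t\ge 1$. A graph $G$ with root $i$ is hang-symmetric at $i$ if $\langle\mathcal E_G^i\cup\mathrm{Aut}(G)\rangle=\mathrm{Sym}(X)$. For a rooted graph $H$, let $H^*$ be $H$ together with one additional isolated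 vertex, with the same root as $H$. For a graph $G$ and a graph $H$ with root $v$, the comb product $G*H$ is the graph on $V(G)\times V(H)$ with edges $(u,v)(u',v)$ for $uu'\in E(G)$ and $(u,w)(u,w')$ for $u\in V(G)$, $ww'\in E(H)$. A graph $H$ with root $i$ is a double-rooted global amoeba if it has minimum degree $1$, the group $\langle\mathcal E_H^i\rangle$ acts transitively on $V(H)\setminus\{i\}$, and some automorphism of $H$ maps $i$ to a vertex other than $i$. **Theorem.** Let $G$ be a global amoeba and let $H$ be a rooted graph such that $H^*$ is hang-symmetric at its root. Then $G*H$ is a global amoeba. This strictly extends the theorem of Hansberg et al. that $G*H$ is a global amoeba whenever $G$ is a nonempty global amoeba and $H$ is a double-rooted global amoeba: if $H$ is a double-rooted global amoeba, then $H^*$ is hang-symmetric at its root; and there is a connected rooted graph $H$ on at least two vertices such that $H^*$ is hang-symmetric at its root while $H$ is not a double-rooted global amoeba. -/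

import Mathlib

/-!
Finite simple graphs whose vertices serve as their own labels; permutations of the label set are
elements of `Equiv.Perm V`.
-/

namespace Amoeba

variable {V : Type*} {W : Type*}

/-- The embedding `G_σ` of `G`: the pair `i j` is an edge iff `σ i, σ j` is an edge of `G`. -/
def embed (G : SimpleGraph V) (σ : Equiv.Perm V) : SimpleGraph V :=
  G.comap σ

/-- The graph `G - e + e'`. -/
def replaceEdge (G : SimpleGraph V) (e e' : Sym2 V) : SimpleGraph V :=
  G.deleteEdges {e} ⊔ SimpleGraph.fromEdgeSet {e'}

/-- `e → e'` is a (non-neutral) feasible edge-replacement of `G`: `e` is an edge of `G`, `e'` is an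
edge of the complement of `G`, and `G - e + e'` is isomorphic to `G`. -/
def IsFeasible (G : SimpleGraph V) (e e' : Sym2 V) : Prop :=
  e ∈ G.edgeSet ∧ e' ∈ Gᶜ.edgeSet ∧ Nonempty (replaceEdge G e e' ≃g G)

/-- The permutations `σ` with `G_σ = G`, i.e. the automorphisms of `G`; these are the permutations
associated with the neutral edge-replacement. -/
def autSet (G : SimpleGraph V) : Set (Equiv.Perm V) :=
  {σ | embed G σ = G}

/-- The permutations associated with the edge-replacement `e → e'`. -/
def ferSet (G : SimpleGraph V) (e e' : Sym2 V) : Set (Equiv.Perm V) :=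
  {σ | replaceEdge G e e' = embed G σ}

/-- `ℰ_G`: all permutations associated with feasible edge-replacements of `G`, including the
neutral one. -/
def replacementPerms (G : SimpleGraph V) : Set (Equiv.Perm V) :=
  {σ | σ ∈ autSet G ∨ ∃ e e', IsFeasible G e e' ∧ σ ∈ ferSet G e e'}

/-- `ℰ_G^i`: the members of `ℰ_G` that fix the label `i`. -/
def replacementPermsFixing (G : SimpleGraph V) (i : V) : Set (Equiv.Perm V) :=
  {σ | σ ∈ replacementPerms G ∧ σ i = i}

/-- The feasible edge-replacement group `Fer(G)`. -/
def fer (G : SimpleGraph V) : Subgroup (Equiv.Perm V) :=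
  Subgroup.closure (replacementPerms G)

/-- `Fer^i(G)`, the subgroup generated by `ℰ_G^i`. -/
def ferFixing (G : SimpleGraph V) (i : V) : Subgroup (Equiv.Perm V) :=
  Subgroup.closure (replacementPermsFixing G i)

/-- The hang group of `G` at `i`, generated by `ℰ_G^i` and the automorphisms of `G`. -/
def hangGroup (G : SimpleGraph V) (i : V) : Subgroup (Equiv.Perm V) :=
  Subgroup.closure (replacementPermsFixing G i ∪ autSet G)

def IsLocalAmoeba (G : SimpleGraph V) : Prop :=
  fer G = ⊤

/-- `G ∪ t K₁` is a local amoeba for some `t ≥ 1`. -/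
def IsGlobalAmoeba (G : SimpleGraph V) : Prop :=
  ∃ t : ℕ, 1 ≤ t ∧ IsLocalAmoeba (G ⊕g (⊥ : SimpleGraph (Fin t)))

def IsHangSymmetric (G : SimpleGraph V) (i : V) : Prop :=
  hangGroup G i = ⊤

/-- `G*`: the graph `G` with one additional isolated vertex. A root `i` of `G` becomes the root
`Sum.inl i` of `G*`. -/
def addIsolated (G : SimpleGraph V) : SimpleGraph (V ⊕ Unit) :=
  G ⊕g (⊥ : SimpleGraph Unit)

/-- The comb product `G * H` of `G` with `H` rooted at `r`: a copy of `H` is glued by its root to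
each vertex of `G`. -/
def combProduct (G : SimpleGraph V) (H : SimpleGraph W) (r : W) : SimpleGraph (V × W) where
  Adj p q := (p.2 = r ∧ q.2 = r ∧ G.Adj p.1 q.1) ∨ (p.1 = q.1 ∧ H.Adj p.2 q.2)
  symm := ⟨by
    rintro p q (⟨hp, hq, h⟩ | ⟨h, h'⟩)
    · exact Or.inl ⟨hq, hp, h.symm⟩
    · exact Or.inr ⟨h.symm, h'.symm⟩⟩
  loopless := ⟨by
    rintro p (⟨_, _, h⟩ | ⟨_, h⟩)
    · exact h.ne rfl
    · exact h.ne rfl⟩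

/-- `Fer^i(G)` acts transitively on the labels other than `i`. -/
def IsStemTransitive (G : SimpleGraph V) (i : V) : Prop :=
  ∀ x y : V, x ≠ i → y ≠ i → ∃ σ ∈ ferFixing G i, σ x = y

/-- Some automorphism of `G` maps the root `i` to a different vertex. -/
def HasRootSimilarVertex (G : SimpleGraph V) (i : V) : Prop :=
  ∃ j : V, j ≠ i ∧ ∃ φ ∈ autSet G, φ i = j

open Classical in
/-- `G`, rooted at `i`, is a double-rooted global amoeba. -/
def IsDoubleRooted [Fintype V] (G : SimpleGraph V) (i : V) : Prop :=
  G.minDegree = 1 ∧ IsStemTransitive G i ∧ HasRootSimilarVertex G i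

end Amoeba

namespace Amoeba

open Equiv

/-! ### Counting created edges, and transpositions -/

section Basic

variable {V W : Type*}

/-! Let z be one added isolated vertex; it suffices that Fer((G*H) ∪ z) contains every transposition
(x z). Fer(G) moves each vertex of G to one of degree at most 1
(`IsGlobalAmoeba.exists_fer_neighborSet_subsingleton`) and acts on G*H by permuting whole copies of
H (`exists_mem_fer_combProduct`), so by conjugation only copies at vertices u of degree at most 1
matter. Such a copy together with z is H*, joined to the rest by at most one edge, at the root.
Extended by the identity, members of ℰ_{H*} fixing the root leave that edge alone, and automorphisms
of H* move no other edge. So the hang group of H*, which is the full symmetric group, embeds in Fer.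

If H has a leaf other than its root, transitivity of its hang group makes H* hang-symmetric. This
covers double-rooted H, and also a spider rooted at 1, where every replacement fixing 1 fixes 4 but
an automorphism moves 4. -/

theorem edgeSet_replaceEdge (G : SimpleGraph V) {e e' : Sym2 V} (h : e' ∈ Gᶜ.edgeSet) :
    (replaceEdge G e e').edgeSet = G.edgeSet \ {e} ∪ {e'} := by
  have hd : ¬ e'.IsDiag := Gᶜ.not_isDiag_of_mem_edgeSet h
  rw [replaceEdge, SimpleGraph.edgeSet_sup, SimpleGraph.edgeSet_deleteEdges,
    SimpleGraph.edgeSet_fromEdgeSet]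
  congr 1
  ext x
  simp only [Set.mem_sdiff, Set.mem_singleton_iff, Sym2.mem_diagSet]
  exact ⟨fun hx => hx.1, fun hx => ⟨hx, hx ▸ hd⟩⟩

theorem ncard_edgeSet_embed (G : SimpleGraph V) (σ : Perm V) :
    (embed G σ).edgeSet.ncard = G.edgeSet.ncard :=
  Nat.card_congr (SimpleGraph.Iso.comap σ G).mapEdgeSet

theorem ncard_edgeSet_diff [Finite V] (G : SimpleGraph V) (σ : Perm V) :
    ((embed G σ).edgeSet \ G.edgeSet).ncard = (G.edgeSet \ (embed G σ).edgeSet).ncard :=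
  (Set.ncard_eq_ncard_iff_ncard_sdiff_eq_ncard_sdiff (Set.toFinite _) (Set.toFinite _)).1
    (ncard_edgeSet_embed G σ)

/-- On a finite vertex set, a permutation belongs to `ℰ_G` iff `G_σ` has at most one edge that is
not an edge of `G`. -/
theorem mem_replacementPerms_iff_subsingleton [Finite V] {G : SimpleGraph V} {σ : Perm V} :
    σ ∈ replacementPerms G ↔ ((embed G σ).edgeSet \ G.edgeSet).Subsingleton := by
  constructor
  · rintro (h | ⟨e, e', ⟨-, he', -⟩, h⟩)
    · rw [show embed G σ = G from h, Set.sdiff_self]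
      exact Set.subsingleton_empty
    · rw [← show replaceEdge G e e' = embed G σ from h, edgeSet_replaceEdge G he']
      refine Set.subsingleton_singleton.anti (t := {e'}) ?_
      rintro x ⟨hx | hx, hx'⟩
      · exact absurd hx.1 hx'
      · exact hx
  · intro h
    -- Equal edge counts: if one edge is created then exactly one is lost, and if none is created
    -- none is lost.
    have hc := ncard_edgeSet_diff G σ
    rcases h.eq_empty_or_singleton with h | ⟨e', he'⟩
    · left
      rw [h, Set.ncard_empty, eq_comm, Set.ncard_eq_zero (Set.toFinite _)] at hc
      exact SimpleGraph.edgeSet_injective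
        ((Set.sdiff_eq_empty.1 h).antisymm (Set.sdiff_eq_empty.1 hc))
    · right
      rw [he', Set.ncard_singleton, eq_comm, Set.ncard_eq_one] at hc
      obtain ⟨e, he⟩ := hc
      have he'1 : e' ∈ (embed G σ).edgeSet \ G.edgeSet := by rw [he']; rfl
      have he1 : e ∈ G.edgeSet \ (embed G σ).edgeSet := by rw [he]; rfl
      have hcompl : e' ∈ Gᶜ.edgeSet := by
        have h1 := (embed G σ).not_isDiag_of_mem_edgeSet he'1.1
        have h2 := he'1.2
        induction e' with
        | _ a b =>
          rw [SimpleGraph.mem_edgeSet, SimpleGraph.compl_adj]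
          exact ⟨by simpa using h1, h2⟩
      have key : replaceEdge G e e' = embed G σ := by
        apply SimpleGraph.edgeSet_injective
        rw [edgeSet_replaceEdge G hcompl, ← he, ← he', Set.sdiff_sdiff_right_self,
          Set.inter_comm, Set.inter_union_sdiff]
      exact ⟨e, e', ⟨he1.1, hcompl, ⟨key ▸ SimpleGraph.Iso.comap σ G⟩⟩, key⟩

theorem mem_replacementPerms_iff [Finite V] {G : SimpleGraph V} {σ : Perm V} :
    σ ∈ replacementPerms G ↔ ∀ a b c d, G.Adj (σ a) (σ b) → ¬ G.Adj a b → G.Adj (σ c) (σ d) →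
      ¬ G.Adj c d → s(a, b) = s(c, d) := by
  rw [mem_replacementPerms_iff_subsingleton]
  constructor
  · intro h a b c d h1 h2 h3 h4
    exact h (x := s(a, b)) ⟨h1, h2⟩ (y := s(c, d)) ⟨h3, h4⟩
  · rintro h ⟨a, b⟩ ⟨h1, h2⟩ ⟨c, d⟩ ⟨h3, h4⟩
    exact h a b c d h1 h2 h3 h4

theorem eq_of_mem_replacementPerms [Finite V] {G : SimpleGraph V} {σ : Perm V}
    (hσ : σ ∈ replacementPerms G) {a b c d : V} (h1 : G.Adj a b) (h2 : ¬ G.Adj (σ a) (σ b))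
    (h3 : G.Adj c d) (h4 : ¬ G.Adj (σ c) (σ d)) : s(a, b) = s(c, d) := by
  rw [mem_replacementPerms_iff_subsingleton, ← Set.ncard_le_one_iff_subsingleton,
    ncard_edgeSet_diff, Set.ncard_le_one_iff_subsingleton] at hσ
  exact hσ (x := s(a, b)) ⟨h1, h2⟩ (y := s(c, d)) ⟨h3, h4⟩

theorem mem_autSet_iff {G : SimpleGraph V} {σ : Perm V} :
    σ ∈ autSet G ↔ ∀ a b, G.Adj (σ a) (σ b) ↔ G.Adj a b := by
  constructor
  · intro h a b
    conv_rhs => rw [← show embed G σ = G from h]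
    rfl
  · intro h
    ext a b
    exact h a b

/-- A permutation `τ` belongs to `ℰ_K` if all edges it creates are images of edges created by some
`σ ∈ ℰ_J`. -/
theorem mem_replacementPerms_of_map [Finite V] [Finite W] {J : SimpleGraph W}
    {K : SimpleGraph V} (ι : W → V) {σ : Perm W} (hσ : σ ∈ replacementPerms J) {τ : Perm V}
    (h : ∀ p q, K.Adj (τ p) (τ q) → ¬ K.Adj p q →
      ∃ a b, p = ι a ∧ q = ι b ∧ J.Adj (σ a) (σ b) ∧ ¬ J.Adj a b) :
    τ ∈ replacementPerms K := by
  rw [mem_replacementPerms_iff] at hσ ⊢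
  intro p q p' q' h1 h2 h3 h4
  obtain ⟨a, b, rfl, rfl, h5, h6⟩ := h p q h1 h2
  obtain ⟨c, d, rfl, rfl, h7, h8⟩ := h p' q' h3 h4
  exact congrArg (Sym2.map ι) (hσ a b c d h5 h6 h7 h8)

theorem eq_top_of_swap_mem [Finite V] [DecidableEq V] {Γ : Subgroup (Perm V)} (z : V)
    (h : ∀ x, swap x z ∈ Γ) : Γ = ⊤ := by
  rw [eq_top_iff, ← Perm.closure_isSwap, Subgroup.closure_le]
  rintro _ ⟨x, y, hxy, rfl⟩
  rcases eq_or_ne x z with rfl | hxz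
  · rw [swap_comm]
    exact h y
  · have := Γ.mul_mem (Γ.mul_mem (h y) (h x)) (h y)
    rwa [swap_comm y z, swap_mul_swap_mul_swap hxz hxy, swap_comm] at this

theorem swap_mem_of_swap_apply_mem [DecidableEq V] {Γ : Subgroup (Perm V)} {ρ : Perm V}
    (hρ : ρ ∈ Γ) {x y : V} (h : swap (ρ x) (ρ y) ∈ Γ) : swap x y ∈ Γ := by
  rw [swap_apply_apply] at h
  exact (Γ.mul_mem_cancel_left hρ).1 ((Γ.mul_mem_cancel_right (inv_mem hρ)).1 h)

section SumBot

variable (G : SimpleGraph V)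

theorem sum_bot_adj_inl_inl (a b : V) :
    (G ⊕g (⊥ : SimpleGraph W)).Adj (.inl a) (.inl b) ↔ G.Adj a b :=
  Iff.rfl

theorem not_sum_bot_adj_inr_left (a : W) (x : V ⊕ W) :
    ¬ (G ⊕g (⊥ : SimpleGraph W)).Adj (.inr a) x := by
  cases x <;> simp

theorem not_sum_bot_adj_inr_right (x : V ⊕ W) (a : W) :
    ¬ (G ⊕g (⊥ : SimpleGraph W)).Adj x (.inr a) := by
  cases x <;> simp

end SumBot

end Basic

/-! ### Extending permutations of a subgraph by the identity -/

section ViaEmbedding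

variable {X Y : Type*} [Finite X]

/-- By `h` no edge between the range of `ι` and its complement is created, so the created edges are
those of `σ`. -/
theorem viaEmbedding_mem_replacementPerms [Finite Y] {J : SimpleGraph Y} {K : SimpleGraph X}
    (ι : Y ↪ X) (hι : ∀ a b, K.Adj (ι a) (ι b) ↔ J.Adj a b) {σ : Perm Y} (hσ : σ ∈ replacementPerms J)
    (h : ∀ x ∉ Set.range ι, ∀ y, K.Adj x (ι (σ y)) → K.Adj x (ι y)) :
    σ.viaEmbedding ι ∈ replacementPerms K := by
  refine mem_replacementPerms_of_map ι hσ fun p q h1 h2 => ?_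
  by_cases hp : p ∈ Set.range ι <;> by_cases hq : q ∈ Set.range ι
  · obtain ⟨a, rfl⟩ := hp
    obtain ⟨b, rfl⟩ := hq
    rw [Perm.viaEmbedding_apply, Perm.viaEmbedding_apply, hι] at h1
    rw [hι] at h2
    exact ⟨a, b, rfl, rfl, h1, h2⟩
  · obtain ⟨a, rfl⟩ := hp
    rw [Perm.viaEmbedding_apply, Perm.viaEmbedding_apply_of_notMem _ _ _ hq] at h1
    exact absurd (h q hq a h1.symm).symm h2
  · obtain ⟨b, rfl⟩ := hq
    rw [Perm.viaEmbedding_apply, Perm.viaEmbedding_apply_of_notMem _ _ _ hp] at h1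
    exact absurd (h p hp b h1) h2
  · rw [Perm.viaEmbedding_apply_of_notMem _ _ _ hp,
      Perm.viaEmbedding_apply_of_notMem _ _ _ hq] at h1
    exact absurd h1 h2

/-- An automorphism creates nothing inside the range, and by `h` at most one edge leaves the range.
-/
theorem viaEmbedding_mem_replacementPerms_of_mem_autSet {J : SimpleGraph Y} {K : SimpleGraph X}
    (ι : Y ↪ X) (hι : ∀ a b, K.Adj (ι a) (ι b) ↔ J.Adj a b) {σ : Perm Y} (hσ : σ ∈ autSet J)
    (h : ∀ x ∉ Set.range ι, ∀ x' ∉ Set.range ι, ∀ y y', K.Adj x (ι y) → K.Adj x' (ι y') →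
      x = x' ∧ y = y') :
    σ.viaEmbedding ι ∈ replacementPerms K := by
  have key : ∀ p q, K.Adj (σ.viaEmbedding ι p) (σ.viaEmbedding ι q) → ¬ K.Adj p q →
      ∃ x ∉ Set.range ι, ∃ y, K.Adj x (ι (σ y)) ∧ s(p, q) = s(x, ι y) := by
    intro p q h1 h2
    by_cases hp : p ∈ Set.range ι <;> by_cases hq : q ∈ Set.range ι
    · obtain ⟨a, rfl⟩ := hp
      obtain ⟨b, rfl⟩ := hq
      rw [Perm.viaEmbedding_apply, Perm.viaEmbedding_apply, hι, mem_autSet_iff.1 hσ] at h1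
      exact absurd ((hι a b).2 h1) h2
    · obtain ⟨a, rfl⟩ := hp
      rw [Perm.viaEmbedding_apply, Perm.viaEmbedding_apply_of_notMem _ _ _ hq] at h1
      exact ⟨q, hq, a, h1.symm, Sym2.eq_swap⟩
    · obtain ⟨b, rfl⟩ := hq
      rw [Perm.viaEmbedding_apply, Perm.viaEmbedding_apply_of_notMem _ _ _ hp] at h1
      exact ⟨p, hp, b, h1, rfl⟩
    · rw [Perm.viaEmbedding_apply_of_notMem _ _ _ hp,
        Perm.viaEmbedding_apply_of_notMem _ _ _ hq] at h1
      exact absurd h1 h2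
  rw [mem_replacementPerms_iff]
  intro p q p' q' h1 h2 h3 h4
  obtain ⟨x, hx, y, hxy, e⟩ := key p q h1 h2
  obtain ⟨x', hx', y', hxy', e'⟩ := key p' q' h3 h4
  obtain ⟨rfl, hy⟩ := h x hx x' hx' _ _ hxy hxy'
  rw [e, e', σ.injective hy]

end ViaEmbedding

/-! ### Reaching vertices of degree at most 1 -/

section GlobalAmoeba

variable {V U : Type*} [Finite V] [Finite U]

/-- A permutation associated with an edge-replacement of `G` plus isolated vertices agrees, on the
vertices of `G` that it does not map to added vertices, with one associated with an
edge-replacement of `G`. -/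
theorem exists_mem_replacementPerms_of_sum {G : SimpleGraph V} {σ : Perm (V ⊕ U)}
    (hσ : σ ∈ replacementPerms (G ⊕g (⊥ : SimpleGraph U))) :
    ∃ σ' ∈ replacementPerms G, ∀ v w, σ (.inl v) = .inl w → σ' v = w := by
  classical
  have := Fintype.ofFinite V
  let e : {v : V // (σ (.inl v)).isLeft} ≃ {w : V // (σ.symm (.inl w)).isLeft} :=
    { toFun := fun v => ⟨(σ (.inl v.1)).getLeft v.2, by simp⟩
      invFun := fun w => ⟨(σ.symm (.inl w.1)).getLeft w.2, by simp⟩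
      left_inv := fun v => by simp
      right_inv := fun w => by simp }
  let σ' : Perm V := e.extendSubtype
  have hσ' : ∀ v w, σ (.inl v) = .inl w → σ' v = w := by
    intro v w h
    have hv : (σ (.inl v)).isLeft := by simp [h]
    rw [show σ' v = _ from e.extendSubtype_apply_of_mem v hv]
    simp [e, h]
  refine ⟨σ', ?_, hσ'⟩
  -- Each `g v` is `v` itself or an added vertex, so `g` injects the edges created by `σ'` into
  -- those created by `σ`.
  let g : V → V ⊕ U := fun v => σ.symm (.inl (σ' v))
  have hg : Function.Injective g := fun v w h => by simpa [g] using h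
  have hσg : ∀ v, σ (g v) = .inl (σ' v) := fun v => by simp [g]
  have hgl : ∀ v w, g v = .inl w → v = w := fun v w h => by
    have := hσ' w (σ' v) (by rw [← h, hσg])
    exact (σ'.injective this).symm
  have hadj : ∀ a b, (G ⊕g (⊥ : SimpleGraph U)).Adj (g a) (g b) → G.Adj a b := by
    intro a b h
    rcases ha : g a with x | x <;> rcases hb : g b with y | y <;> rw [ha, hb] at h <;> simp at h
    rwa [hgl a x ha, hgl b y hb]
  rw [mem_replacementPerms_iff] at hσ ⊢
  intro a b c d h1 h2 h3 h4
  apply Sym2.map.injective hg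
  exact hσ (g a) (g b) (g c) (g d) (by simpa [hσg] using h1) (fun h => h2 (hadj _ _ h))
    (by simpa [hσg] using h3) (fun h => h4 (hadj _ _ h))

/-- In a product of replacements taking `v` to an added vertex, some factor is the first to leave
`G`. The vertex it moves out loses all its edges, hence had at most one; the earlier factors agree
along the path of `v` with members of ℰ_G. -/
theorem IsGlobalAmoeba.exists_fer_neighborSet_subsingleton {G : SimpleGraph V}
    (hG : IsGlobalAmoeba G) (v : V) : ∃ τ ∈ fer G, (G.neighborSet (τ v)).Subsingleton := by
  obtain ⟨t, ht, hG⟩ := hG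
  let P : V ⊕ Fin t → Prop :=
    Sum.elim (fun v => ∃ τ ∈ fer G, (G.neighborSet (τ v)).Subsingleton) fun _ => True
  have step : ∀ σ ∈ replacementPerms (G ⊕g (⊥ : SimpleGraph (Fin t))), ∀ x, P (σ x) → P x := by
    rintro σ hσ (x | x) hx
    · rcases hy : σ (.inl x) with y | y
      · rw [hy] at hx
        obtain ⟨τ, hτ, h⟩ := hx
        obtain ⟨σ', hσ', hσx⟩ := exists_mem_replacementPerms_of_sum hσ
        refine ⟨τ * σ', (fer G).mul_mem hτ (Subgroup.subset_closure hσ'), ?_⟩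
        rwa [Perm.mul_apply, hσx x y hy]
      · refine ⟨1, one_mem _, fun a ha b hb => ?_⟩
        have := eq_of_mem_replacementPerms hσ (a := .inl x) (b := .inl a) (c := .inl x)
          (d := .inl b) (by simpa using ha) (by rw [hy]; exact not_sum_bot_adj_inr_left G _ _)
          (by simpa using hb) (by rw [hy]; exact not_sum_bot_adj_inr_left G _ _)
        have : a = b ∨ x = b ∧ a = x := by simpa using this
        grind
    · trivial
  -- `P` passes only from `σ x` to `x`, so inverses are avoided; in a finite group the generated
  -- submonoid is the generated subgroup.
  have all : ∀ σ ∈ Submonoid.closure (replacementPerms (G ⊕g (⊥ : SimpleGraph (Fin t)))),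
      ∀ x, P (σ x) → P x := by
    intro σ hσ
    induction hσ using Submonoid.closure_induction with
    | mem σ h => exact step σ h
    | one => exact fun x h => h
    | mul σ ρ _ _ h1 h2 => exact fun x h => h2 x (h1 _ h)
  classical
  refine all (swap (.inl v) (.inr ⟨0, ht⟩)) ?_ (.inl v) (by rw [swap_apply_left]; trivial)
  rw [← Subgroup.closure_toSubmonoid_of_finite, show Subgroup.closure _ = _ from hG]
  trivial

end GlobalAmoeba

/-! ### The comb product -/

section Comb

variable {V W : Type*}

/-- The embedding of `W` with one additional label as the copy of `W` at `u`, together with the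
additional label. -/
def copyEmbedding (W : Type*) (u : V) : W ⊕ Unit ↪ (V × W) ⊕ Fin 1 where
  toFun := Sum.map (Prod.mk u) fun _ => 0
  inj' := (Prod.mk_right_injective u).sumMap (Function.injective_of_subsingleton _)

theorem adj_copyEmbedding (G : SimpleGraph V) (H : SimpleGraph W) (r : W) (u : V)
    (a b : W ⊕ Unit) :
    (combProduct G H r ⊕g (⊥ : SimpleGraph (Fin 1))).Adj (copyEmbedding W u a) (copyEmbedding W u b) ↔
      (addIsolated H).Adj a b := by
  rcases a with a | a <;> rcases b with b | b <;>
    simp [addIsolated, copyEmbedding, combProduct]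

theorem adj_of_notMem_range_copyEmbedding {G : SimpleGraph V} {H : SimpleGraph W} {r : W} {u : V}
    {x : (V × W) ⊕ Fin 1} (hx : x ∉ Set.range (copyEmbedding W u)) {y : W ⊕ Unit}
    (h : (combProduct G H r ⊕g (⊥ : SimpleGraph (Fin 1))).Adj x (copyEmbedding W u y)) :
    y = .inl r ∧ ∃ v, x = .inl (v, r) ∧ G.Adj u v := by
  rcases x with ⟨v, w⟩ | x
  · rcases y with y | y
    · have hv : v ≠ u := by
        rintro rfl
        exact hx ⟨.inl w, rfl⟩
      have h : (w = r ∧ y = r ∧ G.Adj v u) ∨ (v = u ∧ H.Adj w y) := by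
        simpa [addIsolated, copyEmbedding, combProduct] using h
      obtain ⟨rfl, rfl, h'⟩ | ⟨h', -⟩ := h
      · exact ⟨rfl, v, rfl, h'.symm⟩
      · exact absurd h' hv
    · simp [copyEmbedding] at h
  · exact absurd ⟨.inr (), by rw [Subsingleton.elim x 0]; rfl⟩ hx

variable [Finite V] [Finite W]

theorem swap_mem_fer_of_neighborSet_subsingleton [DecidableEq V] [DecidableEq W]
    {G : SimpleGraph V} {H : SimpleGraph W} {r : W}
    (hH : IsHangSymmetric (addIsolated H) (.inl r)) {u : V}
    (hu : (G.neighborSet u).Subsingleton) (w : W) :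
    swap (.inl (u, w)) (.inr 0) ∈ fer (combProduct G H r ⊕g (⊥ : SimpleGraph (Fin 1))) := by
  have hle : hangGroup (addIsolated H) (.inl r) ≤
      (fer (combProduct G H r ⊕g (⊥ : SimpleGraph (Fin 1)))).comap (Perm.viaEmbeddingHom (copyEmbedding W u)) := by
    rw [hangGroup, Subgroup.closure_le]
    rintro σ (⟨hσ, hr⟩ | hσ) <;> apply Subgroup.subset_closure
    · refine viaEmbedding_mem_replacementPerms _ (adj_copyEmbedding G H r u) hσ ?_
      intro x hx y h
      have hy := (adj_of_notMem_range_copyEmbedding hx h).1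
      rw [← hr, σ.injective.eq_iff] at hy
      rwa [hy, hr, ← hy] at h
    -- Edges leaving the copy join its root to the roots over neighbours of `u`; `hu` allows only
    -- one.
    · refine viaEmbedding_mem_replacementPerms_of_mem_autSet _ (adj_copyEmbedding G H r u) hσ ?_
      intro x hx x' hx' y y' h h'
      obtain ⟨rfl, v, rfl, hv⟩ := adj_of_notMem_range_copyEmbedding hx h
      obtain ⟨rfl, v', rfl, hv'⟩ := adj_of_notMem_range_copyEmbedding hx' h'
      rw [hu hv hv']
      exact ⟨rfl, rfl⟩
  rw [show hangGroup (addIsolated H) (.inl r) = ⊤ from hH] at hle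
  have := hle (Subgroup.mem_top (swap (.inl w) (.inr ())))
  rw [Subgroup.mem_comap, Perm.viaEmbeddingHom_apply] at this
  convert this
  ext x
  by_cases hx : x ∈ Set.range (copyEmbedding W u)
  · obtain ⟨y, rfl⟩ := hx
    rw [Perm.viaEmbedding_apply]
    exact (copyEmbedding W u).swap_apply (.inl w) (.inr ()) y
  · rw [Perm.viaEmbedding_apply_of_notMem _ _ _ hx, swap_apply_of_ne_of_ne]
    · rintro rfl
      exact hx ⟨.inl w, rfl⟩
    · rintro rfl
      exact hx ⟨.inr (), rfl⟩

/-- For a generator `τ`, the map `τ × id` carries copies of `H` rigidly onto copies, so it creates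
only the root edges that `τ` creates in `G`. -/
theorem exists_mem_fer_combProduct (G : SimpleGraph V) (H : SimpleGraph W) (r : W) {τ : Perm V}
    (hτ : τ ∈ fer G) : ∃ ρ ∈ fer (combProduct G H r ⊕g (⊥ : SimpleGraph (Fin 1))),
      (∀ v w, ρ (.inl (v, w)) = .inl (τ v, w)) ∧ ρ (.inr 0) = .inr 0 := by
  refine ⟨sumCongr (prodCongr τ 1) 1, ?_, fun _ _ => rfl, rfl⟩
  induction hτ using Subgroup.closure_induction with
  | mem τ h =>
    refine Subgroup.subset_closure (mem_replacementPerms_of_map (fun v => .inl (v, r)) h ?_)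
    rintro (⟨v, w⟩ | p) (⟨v', w'⟩ | q) h1 h2
    · simp only [combProduct, sum_bot_adj_inl_inl, sumCongr_apply, Sum.map_inl, prodCongr_apply,
        Prod.map, Perm.coe_one, id, τ.injective.eq_iff] at h1 h2
      grind
    all_goals simp at h1
  | one =>
    convert one_mem (fer _)
    ext (x | x) <;> rfl
  | mul σ ρ _ _ h1 h2 =>
    convert mul_mem h1 h2
    ext (x | x) <;> rfl
  | inv σ _ h =>
    convert inv_mem h
    rfl

theorem IsGlobalAmoeba.combProduct {G : SimpleGraph V} (hG : IsGlobalAmoeba G)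
    {H : SimpleGraph W} {r : W} (hH : IsHangSymmetric (addIsolated H) (.inl r)) :
    IsGlobalAmoeba (combProduct G H r) := by
  classical
  refine ⟨1, le_rfl, eq_top_of_swap_mem (.inr 0) ?_⟩
  rintro (⟨v, w⟩ | x)
  · obtain ⟨τ, hτ, hv⟩ := hG.exists_fer_neighborSet_subsingleton v
    obtain ⟨ρ, hρ, hρ1, hρ2⟩ := exists_mem_fer_combProduct G H r hτ
    refine swap_mem_of_swap_apply_mem hρ ?_
    rw [hρ1, hρ2]
    exact swap_mem_fer_of_neighborSet_subsingleton hH hv w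
  · rw [show swap (Sum.inr x : (V × W) ⊕ Fin 1) (.inr 0) = 1 by rw [Subsingleton.elim x 0]; exact swap_self _]
    exact one_mem _

end Comb

/-! ### Double-rooted global amoebas -/

section DoubleRooted

variable {W : Type*} [Finite W]

/-- If the hang group of `H` is transitive and `H` has a leaf other than its root, then `H*` is
hang-symmetric. -/
theorem isHangSymmetric_addIsolated {H : SimpleGraph W} {r l : W}
    (hH : ∀ x, ∃ σ ∈ hangGroup H r, σ x = l) (hlr : l ≠ r)
    (hl : (H.neighborSet l).Subsingleton) :
    IsHangSymmetric (addIsolated H) (.inl r) := by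
  classical
  -- Only the pendant edge at `l`, if any, moves: its end becomes the new vertex.
  have hswap : swap (.inl l) (.inr ()) ∈ hangGroup (addIsolated H) (.inl r) := by
    refine Subgroup.subset_closure (.inl ⟨?_, swap_apply_of_ne_of_ne (by simpa using hlr.symm)
      (by simp)⟩)
    have key : ∀ a b, (addIsolated H).Adj (swap (.inl l) (.inr ()) a) (swap (.inl l) (.inr ()) b) →
        ¬ (addIsolated H).Adj a b → ∃ v, H.Adj l v ∧ s(a, b) = s(.inr (), .inl v) := by
      rintro (a | a) (b | b) h1 h2
      · rcases eq_or_ne a l with rfl | ha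
        · rw [swap_apply_left] at h1
          exact absurd h1 (not_sum_bot_adj_inr_left H _ _)
        rcases eq_or_ne b l with rfl | hb
        · rw [swap_apply_left] at h1
          exact absurd h1 (not_sum_bot_adj_inr_right H _ _)
        · simp [addIsolated, swap_apply_def, ha, hb] at h1 h2
          exact absurd h1 h2
      · rcases eq_or_ne a l with rfl | ha
        · simp [addIsolated] at h1
        · simp [addIsolated, swap_apply_def, ha] at h1
          exact ⟨a, h1.symm, Sym2.eq_swap⟩
      · rcases eq_or_ne b l with rfl | hb
        · simp [addIsolated] at h1
        · simp [addIsolated, swap_apply_def, hb] at h1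
          exact ⟨b, h1, rfl⟩
      · simp [addIsolated] at h1
    rw [mem_replacementPerms_iff]
    intro a b c d h1 h2 h3 h4
    obtain ⟨v, hv, e⟩ := key a b h1 h2
    obtain ⟨v', hv', e'⟩ := key c d h3 h4
    rw [e, e', hl hv hv']
  have hlift : ∀ σ ∈ hangGroup H r,
      (sumCongr σ 1 : Perm (W ⊕ Unit)) ∈ hangGroup (addIsolated H) (.inl r) := by
    intro σ hσ
    induction hσ using Subgroup.closure_induction with
    | mem σ h =>
      apply Subgroup.subset_closure
      rcases h with ⟨h, hr⟩ | h
      · refine .inl ⟨mem_replacementPerms_of_map .inl h ?_, by simp [hr]⟩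
        rintro (a | a) (b | b) h1 h2
        · simp [addIsolated] at h1 h2
          exact ⟨a, b, rfl, rfl, h1, h2⟩
        all_goals simp [addIsolated] at h1
      · right
        rw [mem_autSet_iff] at h ⊢
        rintro (a | a) (b | b) <;> simp [addIsolated, h]
    | one =>
      convert one_mem (hangGroup _ _)
      ext (x | x) <;> rfl
    | mul σ ρ _ _ h1 h2 =>
      convert mul_mem h1 h2
      ext (x | x) <;> rfl
    | inv σ _ h =>
      convert inv_mem h
      rfl
  refine eq_top_of_swap_mem (.inr ()) ?_
  rintro (x | x)
  · obtain ⟨σ, hσ, hx⟩ := hH x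
    refine swap_mem_of_swap_apply_mem (hlift σ hσ) ?_
    simpa [hx] using hswap
  · rw [show swap (Sum.inr x : W ⊕ Unit) (.inr ()) = 1 from swap_self _]
    exact one_mem _

theorem IsDoubleRooted.isHangSymmetric_addIsolated {W : Type*} [Fintype W] {H : SimpleGraph W}
    {r : W} (h : IsDoubleRooted H r) : IsHangSymmetric (addIsolated H) (.inl r) := by
  classical
  obtain ⟨hmin, htrans, j, hj, φ, hφ, hφr⟩ := h
  have hleaf : ∃ l, l ≠ r ∧ (H.neighborSet l).Subsingleton := by
    have : Nonempty W := ⟨r⟩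
    obtain ⟨l, hl⟩ := H.exists_minimal_degree_vertex
    rw [hmin] at hl
    have hl : (H.neighborSet l).Subsingleton := by
      rw [eq_comm, SimpleGraph.degree, Finset.card_eq_one] at hl
      obtain ⟨a, ha⟩ := hl
      rw [← SimpleGraph.coe_neighborFinset, ha, Finset.coe_singleton]
      exact Set.subsingleton_singleton
    -- If the leaf found is the root, its image `j` under the automorphism is another leaf.
    rcases eq_or_ne l r with rfl | hlr
    · refine ⟨j, hj, fun x hx y hy => ?_⟩
      rw [mem_autSet_iff] at hφ
      refine φ.symm.injective (hl ?_ ?_)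
      · rwa [SimpleGraph.mem_neighborSet, ← hφ, hφr, apply_symm_apply]
      · rwa [SimpleGraph.mem_neighborSet, ← hφ, hφr, apply_symm_apply]
    · exact ⟨l, hlr, hl⟩
  obtain ⟨l, hlr, hl⟩ := hleaf
  have hsub : ferFixing H r ≤ hangGroup H r := Subgroup.closure_mono Set.subset_union_left
  refine Amoeba.isHangSymmetric_addIsolated (fun x => ?_) hlr hl
  rcases eq_or_ne x r with rfl | hx
  · obtain ⟨σ, hσ, h⟩ := htrans j l hj hlr
    exact ⟨σ * φ, mul_mem (hsub hσ) (Subgroup.subset_closure (.inr hφ)), by simp [hφr, h]⟩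
  · obtain ⟨σ, hσ, h⟩ := htrans x l hx hlr
    exact ⟨σ, hsub hσ, h⟩

end DoubleRooted

/-! ### A hang-symmetric example that is not double-rooted -/

section Spider

/-- The tree with a centre `0` to which a leaf `5` and two paths `1, 4` and `2, 3` are attached. -/
def spider : SimpleGraph (Fin 6) :=
  SimpleGraph.fromEdgeSet {s(0, 1), s(0, 2), s(0, 5), s(1, 4), s(2, 3)}

instance : DecidableRel spider.Adj := fun a b =>
  decidable_of_iff ((s(a, b) = s(0, 1) ∨ s(a, b) = s(0, 2) ∨ s(a, b) = s(0, 5) ∨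
    s(a, b) = s(1, 4) ∨ s(a, b) = s(2, 3)) ∧ a ≠ b) (by simp [spider])

theorem spider_connected : spider.Connected := by
  have h0 : ∀ x, spider.Reachable 0 x := by
    have h1 : spider.Reachable 0 1 := SimpleGraph.Adj.reachable (by decide)
    have h2 : spider.Reachable 0 2 := SimpleGraph.Adj.reachable (by decide)
    intro x
    fin_cases x
    · exact .refl _
    · exact h1
    · exact h2
    · exact h2.trans (SimpleGraph.Adj.reachable (by decide))
    · exact h1.trans (SimpleGraph.Adj.reachable (by decide))
    · exact SimpleGraph.Adj.reachable (by decide)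
  exact (SimpleGraph.connected_iff_exists_forall_reachable _).2 ⟨0, h0⟩

/-- Replacements fixing 1 join 0, 2, 3, 5 into one orbit; the automorphism exchanging the two long
legs brings in 1 and 4. -/
theorem spider_transitive (x : Fin 6) : ∃ σ ∈ hangGroup spider 1, σ x = 3 := by
  have h1 : swap 2 3 ∈ hangGroup spider 1 := by
    refine Subgroup.subset_closure (.inl ⟨?_, by decide⟩)
    rw [mem_replacementPerms_iff]
    decide
  have h2 : swap 2 5 ∈ hangGroup spider 1 := by
    refine Subgroup.subset_closure (.inl ⟨?_, by decide⟩)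
    rw [mem_replacementPerms_iff]
    decide
  have h3 : swap 0 2 * swap 3 5 ∈ hangGroup spider 1 := by
    refine Subgroup.subset_closure (.inl ⟨?_, by decide⟩)
    rw [mem_replacementPerms_iff]
    decide
  have h4 : swap 1 2 * swap 3 4 ∈ hangGroup spider 1 := by
    refine Subgroup.subset_closure (.inr ?_)
    rw [mem_autSet_iff]
    decide
  fin_cases x
  · exact ⟨_, mul_mem h1 h3, by decide⟩
  · exact ⟨_, mul_mem h1 h4, by decide⟩
  · exact ⟨_, h1, by decide⟩
  · exact ⟨1, one_mem _, by decide⟩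
  · exact ⟨_, h4, by decide⟩
  · exact ⟨_, mul_mem h1 h2, by decide⟩

set_option synthInstance.maxSize 1000 in
theorem spider_apply_four {σ : Perm (Fin 6)} (hσ : σ ∈ replacementPermsFixing spider 1) :
    σ 4 = 4 := by
  obtain ⟨hσ, h1⟩ := hσ
  have kept : ∀ a b c d, spider.Adj a b → spider.Adj c d → s(a, b) ≠ s(c, d) →
      spider.Adj (σ a) (σ b) ∨ spider.Adj (σ c) (σ d) := by
    intro a b c d hab hcd hne
    by_contra! h
    exact hne (eq_of_mem_replacementPerms hσ hab h.1 hcd h.2)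
  -- Here `xᵢ` stands for `σ i`. At most one edge is lost, so each of the ten pairs of edges keeps a
  -- member. Each condition is imposed as soon as its images are chosen, to prune the search; the
  -- tenth is the negated conclusion.
  have key : ∀ x₄ : Fin 6, x₄ ≠ 4 → x₄ ≠ 1 → ∀ x₀, x₀ ≠ 1 → x₀ ≠ x₄ →
      (spider.Adj 1 x₄ ∨ spider.Adj x₀ 1) →
      ∀ x₂, x₂ ≠ 1 → x₂ ≠ x₄ → x₂ ≠ x₀ →
      (spider.Adj 1 x₄ ∨ spider.Adj x₀ x₂) → (spider.Adj x₀ 1 ∨ spider.Adj x₀ x₂) →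
      ∀ x₃, x₃ ≠ 1 → x₃ ≠ x₄ → x₃ ≠ x₀ → x₃ ≠ x₂ →
      (spider.Adj 1 x₄ ∨ spider.Adj x₂ x₃) → (spider.Adj x₀ 1 ∨ spider.Adj x₂ x₃) →
      (spider.Adj x₀ x₂ ∨ spider.Adj x₂ x₃) →
      ∀ x₅, x₅ ≠ 1 → x₅ ≠ x₄ → x₅ ≠ x₀ → x₅ ≠ x₂ → x₅ ≠ x₃ →
      (spider.Adj 1 x₄ ∨ spider.Adj x₀ x₅) → (spider.Adj x₀ 1 ∨ spider.Adj x₀ x₅) →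
      (spider.Adj x₀ x₂ ∨ spider.Adj x₀ x₅) → ¬ (spider.Adj x₂ x₃ ∨ spider.Adj x₀ x₅) := by
    decide
  by_contra h4
  have hne : ∀ i j, i ≠ j → σ i ≠ σ j := fun i j h => σ.injective.ne h
  rw [← h1] at key
  refine key (σ 4) ?_ ?_ (σ 0) ?_ ?_ ?_ (σ 2) ?_ ?_ ?_ ?_ ?_ (σ 3) ?_ ?_ ?_ ?_ ?_ ?_ ?_
    (σ 5) ?_ ?_ ?_ ?_ ?_ ?_ ?_ ?_ ?_
  all_goals first | exact h4 | exact hne _ _ (by decide) |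
    exact kept _ _ _ _ (by decide) (by decide) (by decide)

theorem not_isDoubleRooted_spider : ¬ IsDoubleRooted spider 1 := by
  rintro ⟨-, h, -⟩
  obtain ⟨σ, hσ, h0⟩ := h 4 0 (by decide) (by decide)
  have : σ 4 = 4 := by
    clear h0
    induction hσ using Subgroup.closure_induction with
    | mem σ h => exact spider_apply_four h
    | one => rfl
    | mul σ ρ _ _ h1 h2 => rw [Perm.mul_apply, h2, h1]
    | inv σ _ h => rw [Perm.inv_eq_iff_eq, h]
  rw [this] at h0
  exact absurd h0 (by decide)

end Spider

end Amoeba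

theorem mainTheorem6 :
    -- the comb product of a global amoeba with a rooted `H` such that `H*` is hang-symmetric
    (∀ {V : Type*} {W : Type*} [Finite V] [Finite W]
        (G : SimpleGraph V) (H : SimpleGraph W) (r : W),
        Amoeba.IsGlobalAmoeba G →
        Amoeba.IsHangSymmetric (Amoeba.addIsolated H) (Sum.inl r) →
        Amoeba.IsGlobalAmoeba (Amoeba.combProduct G H r)) ∧
    -- the condition on `H` covers all double-rooted global amoebas
    (∀ {W : Type*} [Fintype W] (H : SimpleGraph W) (r : W),
        Amoeba.IsDoubleRooted H r →
        Amoeba.IsHangSymmetric (Amoeba.addIsolated H) (Sum.inl r)) ∧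
    -- and it covers other connected rooted graphs as well
    (∃ (n : ℕ) (H : SimpleGraph (Fin n)) (r : Fin n),
        2 ≤ n ∧ H.Connected ∧
        Amoeba.IsHangSymmetric (Amoeba.addIsolated H) (Sum.inl r) ∧
        ¬ Amoeba.IsDoubleRooted H r) := by
  refine ⟨fun G H r hG hH => hG.combProduct hH, fun H r h => h.isHangSymmetric_addIsolated,
    6, Amoeba.spider, 1, by norm_num, Amoeba.spider_connected, ?_,
    Amoeba.not_isDoubleRooted_spider⟩
  refine Amoeba.isHangSymmetric_addIsolated Amoeba.spider_transitive (by decide) ?_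
  exact fun a ha b hb => by revert a b; decide
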